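/- Graphs are finite, connected and undirected, with positive real edge-lengths; $d_G(u,v)$ is the length of a shortest $u$-to-$v$ path in $G$, $B_v(r)=\{u : d_G(v,u)\le r\}$, and $d_G(S,u)=\min_{s\in S}d_G(s,u)$ for a nonempty vertex set $S$. Fix a constant $c>4$. The highway dimension of $G$ is the smallest integer $\eta$ such that for every real $r>0$ and every vertex $v$ there is a set of at most $\eta$ vertices of $B_v(cr)$ that intersects every shortest path of $G$ that has length at least $r$ and all of whose vertices lie in $B_v(cr)$. The treewidth of a graph with edge-lengths is the treewidth of its underlying graph. Theorem. There are a constant $C>0$ and a function $f(\cdot,\cdot,\cdot)$, depending only on $c$, such that for every $\varepsilon>0$, every graph $G$ with vertex set $V$ and highway dimension $\eta$, and every nonempty set $S\subseteq V$, there are a graph $H$ with the same vertex set $V$ and a mapping $\phi:V\to V$ from the vertices of $G$ to the vertices of $H$ such that (1) $H$ has treewidth at most $f(\eta,|S|,\varepsilon)$, and (2) for all $u,v\in V$, $$d_G(u,v)\ \le\ d_H(\phi(u),\phi(v))\ \le\ (1+C\varepsilon)\,d_G(u,v)+\varepsilon\min\bigl(d_G(S,u),d_G(S,v)\bigr).$$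 -/

import Mathlib

/-- An undirected graph on the vertex set `V` with positive real edge-lengths.
Only the values of `len` on edges matter. -/
structure LengthGraph (V : Type*) where
  graph : SimpleGraph V
  len : Sym2 V → ℝ
  len_pos : ∀ e ∈ graph.edgeSet, 0 < len e

namespace LengthGraph

variable {V : Type*}

/-- The length of a walk: the sum of the lengths of its edges. -/
def walkLength (G : LengthGraph V) {u v : V} (p : G.graph.Walk u v) : ℝ :=
  (p.edges.map G.len).sum

/-- The shortest-path distance (meaningful when `u` and `v` are joined by a walk). -/
noncomputable def dist (G : LengthGraph V) (u v : V) : ℝ :=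
  ⨅ p : G.graph.Walk u v, G.walkLength p

/-- The distance `min_{s ∈ S} d(s, v)` from a nonempty vertex set to a vertex. -/
noncomputable def distSet (G : LengthGraph V) (S : Finset V) (hS : S.Nonempty) (v : V) : ℝ :=
  S.inf' hS fun s => G.dist s v

/-- The closed ball with center `v` and radius `r`. -/
def ball (G : LengthGraph V) (v : V) (r : ℝ) : Set V :=
  {u | G.dist v u ≤ r}

/-- `p` is a shortest path between its end points. -/
def IsShortestPath (G : LengthGraph V) {u v : V} (p : G.graph.Walk u v) : Prop :=
  p.IsPath ∧ G.walkLength p = G.dist u v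

/-- For every `r > 0` and every vertex `v` there are at most `η` vertices in the ball
`B_v(c r)` that meet every shortest path in `B_v(c r)` of length at least `r`. -/
def HasHighwayDimLE (G : LengthGraph V) (c : ℝ) (η : ℕ) : Prop :=
  ∀ r : ℝ, 0 < r → ∀ v : V, ∃ Q : Finset V,
    (∀ q ∈ Q, q ∈ G.ball v (c * r)) ∧ Q.card ≤ η ∧
      ∀ (x y : V) (p : G.graph.Walk x y), G.IsShortestPath p →
        (∀ w ∈ p.support, w ∈ G.ball v (c * r)) → r ≤ G.walkLength p →
          ∃ w ∈ p.support, w ∈ Q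

/-- The highway dimension with respect to the constant `c`. -/
noncomputable def highwayDim (G : LengthGraph V) (c : ℝ) : ℕ :=
  sInf {η : ℕ | G.HasHighwayDimLE c η}

/-- On a finite vertex set the minimum defining the highway dimension is attained. -/
theorem hasHighwayDimLE_highwayDim [Finite V] (G : LengthGraph V) (c : ℝ) :
    G.HasHighwayDimLE c (G.highwayDim c) := by
  classical
  have : Fintype V := Fintype.ofFinite V
  refine Nat.sInf_mem (s := {η : ℕ | G.HasHighwayDimLE c η}) ⟨Fintype.card V, ?_⟩
  intro r _ v
  refine ⟨Finset.univ.filter fun w => w ∈ G.ball v (c * r), by simp,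
    Finset.card_le_univ _, ?_⟩
  intro x y p _ hp _
  exact ⟨x, p.start_mem_support, by simpa using hp x p.start_mem_support⟩

end LengthGraph

/-- A tree decomposition of a graph, with tree nodes indexed by `ι`. -/
structure TreeDecomposition {V : Type*} (G : SimpleGraph V) (ι : Type*) where
  tree : SimpleGraph ι
  isTree : tree.IsTree
  bag : ι → Finset V
  vertex_mem : ∀ v, ∃ i, v ∈ bag i
  edge_mem : ∀ u v, G.Adj u v → ∃ i, u ∈ bag i ∧ v ∈ bag i
  connected : ∀ v, (tree.induce {i | v ∈ bag i}).Connected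

/-- The graph has a (finite) tree decomposition of width at most `k`: all bags have at most
`k + 1` elements. -/
def HasTreewidthLE {V : Type*} (G : SimpleGraph V) (k : ℕ) : Prop :=
  ∃ (ι : Type) (_ : Finite ι) (D : TreeDecomposition G ι), ∀ i, (D.bag i).card ≤ k + 1

/-- The treewidth: the minimum width of a tree decomposition. -/
noncomputable def treewidth {V : Type*} (G : SimpleGraph V) : ℕ :=
  sInf {k : ℕ | HasTreewidthLE G k}

/-- On a finite vertex set the minimum defining the treewidth is attained. -/
theorem hasTreewidthLE_treewidth {V : Type*} [Finite V] (G : SimpleGraph V) :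
    HasTreewidthLE G (treewidth G) := by
  classical
  have : Fintype V := Fintype.ofFinite V
  refine Nat.sInf_mem (s := {k : ℕ | HasTreewidthLE G k}) ⟨Fintype.card V, Unit, inferInstance,
    { tree := ⊥
      isTree := SimpleGraph.IsTree.of_subsingleton
      bag := fun _ => Finset.univ
      vertex_mem := by simp
      edge_mem := by simp
      connected := fun v => ?_ }, ?_⟩
  · have : Nonempty {i : Unit | v ∈ (Finset.univ : Finset V)} := ⟨⟨(), by simp⟩⟩
    exact SimpleGraph.IsTree.of_subsingleton.connected
  · intro i
    simp

/-!
The map `φ` is the identity. The graph `H` is a set of pairs of vertices, each with its distance in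
`G` as length, so distances in `H` are never smaller than in `G`; every vertex of `S` is joined to
all vertices. Write `D` for the distance from `S`, `λ = c/4`, and `δ` for a small multiple of
`min ε 1`. Pairs `x, y` with `D x ≤ δ d(x, y)` are served by a detour through `S`. For the others
only the scales `λ ^ ℓ` between about `δ D x` and `D x / δ` matter, a bounded number of them.

A town of scale `ρ` is a cluster of diameter less than `ρ` at distance at least `ρ` from the rest.
Two vertices are in the same class of scale `r` if no town of scale at least `r` separates them;
this holds whenever their distance is less than `r`. If `Q` meets the shortest paths of length at
least `ρ` in a ball of radius `cρ`, a vertex in the ball of radius `(c - 2)ρ` at distance more than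
`2ρ` from `Q` lies in a town of scale `ρ` (`LengthGraph.isTown_of_far`). So within one class, a
cover by balls of radius `(c - 2)ρ` can be replaced by one with radius `2ρ < (c - 2)ρ`: either the
vertices of `Q` are the new centres, or the whole class lies in one town of scale `ρ`. Starting
with balls around `S`, a bounded number of rounds reaches radius `2r`, and one more use of the
highway dimension gives boundedly many hubs per class (`LengthGraph.exists_hubs`). They meet every
shortest path with length in `[r/λ, r)` that starts in the relevant part of the class, and form a
`4r`-net of that part. The first property serves the pairs at distance between `δ D x` and
`D x / δ`; the second one serves the closer pairs, with additive error `ε D x`.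

The level of a hub is the largest scale at which it is used. A vertex is joined to the hubs in its
class, at the scale of the hub, whose levels exceed its own by a bounded amount. Eliminating
vertices by increasing level, the later neighbours of a vertex are boundedly many, and they are
pairwise compatible because classes grow with the scale. Hence the treewidth is bounded
(`hasTreewidthLE_of_elimination`, `LengthGraph.hasTreewidthLE_hubGraph`).
-/

/-! ### Treewidth from elimination orders -/

/-- Pointing every positive index to a smaller one yields a tree. -/
theorem isTree_fromRel_parent {n : ℕ} (p : Fin (n + 1) → Fin (n + 1))
    (hp : ∀ i, i ≠ 0 → p i < i) :
    (SimpleGraph.fromRel fun i j => i ≠ 0 ∧ p i = j).IsTree := by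
  classical
  set T := SimpleGraph.fromRel fun i j : Fin (n + 1) => i ≠ 0 ∧ p i = j with hT
  have hadj : ∀ i, i ≠ 0 → T.Adj i (p i) := fun i hi => by
    rw [hT, SimpleGraph.fromRel_adj]
    exact ⟨(hp i hi).ne', Or.inl ⟨hi, rfl⟩⟩
  have hreach : ∀ i, T.Reachable 0 i := by
    intro i
    induction i using WellFoundedLT.induction with
    | ind i ih =>
      by_cases hi : i = 0
      · rw [hi]
      · exact (ih _ (hp i hi)).trans (hadj i hi).symm.reachable
  have hconn : T.Connected := SimpleGraph.connected_iff_exists_forall_reachable _ |>.2 ⟨0, hreach⟩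
  refine SimpleGraph.isTree_iff_connected_and_card.2
    ⟨hconn, le_antisymm ?_ hconn.card_vert_le_card_edgeSet_add_one⟩
  have hsub : T.edgeSet ⊆ (Finset.univ.erase (0 : Fin (n + 1))).image fun i => s(i, p i) := by
    intro e
    induction e with
    | h i j =>
      rw [SimpleGraph.mem_edgeSet, hT, SimpleGraph.fromRel_adj]
      rintro ⟨-, ⟨hi, hij⟩ | ⟨hj, hji⟩⟩
      · exact Finset.mem_coe.2 (Finset.mem_image.2 ⟨i, by simpa using hi, by rw [hij]⟩)
      · exact Finset.mem_coe.2 (Finset.mem_image.2 ⟨j, by simpa using hj, by rw [hji, Sym2.eq_swap]⟩)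
  have hle : T.edgeSet.ncard ≤ n := by
    refine (Set.ncard_le_ncard hsub (Finset.finite_toSet _)).trans ?_
    rw [Set.ncard_coe_finset]
    refine Finset.card_image_le.trans ?_
    simp
  rw [Nat.card_coe_set_eq, Nat.card_eq_fintype_card, Fintype.card_fin]
  omega

/-- The elimination-order criterion for small treewidth, with apex set `S`. Suppose every vertex
`x` has a set `A x` of vertices of larger key such that of two members of `A x` the one with the
larger key belongs to the set of the other. If every edge avoiding `S` joins some `x` to a member
of `A x`, then the bags `{x} ∪ A x ∪ S` form a tree decomposition, in which the parent of `x` is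
the member of `A x` with the smallest key. -/
theorem hasTreewidthLE_of_elimination {V K : Type*} [Finite V] [Nonempty V] [LinearOrder K]
    (G : SimpleGraph V) (key : V → K) (hkey : Function.Injective key) (A : V → Finset V)
    (S : Finset V) (k : ℕ) (hA : ∀ x, ∀ a ∈ A x, key x < key a)
    (hclique : ∀ x, ∀ a ∈ A x, ∀ b ∈ A x, key b < key a → a ∈ A b)
    (hadj : ∀ x y, G.Adj x y → x ∈ S ∨ y ∈ S ∨ x ∈ A y ∨ y ∈ A x)
    (hcard : ∀ x, (A x).card + S.card ≤ k) : HasTreewidthLE G k := by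
  classical
  have : Fintype V := Fintype.ofFinite V
  obtain ⟨n, hn⟩ : ∃ n, Fintype.card V = n + 1 :=
    ⟨Fintype.card V - 1, (Nat.succ_pred_eq_of_pos Fintype.card_pos).symm⟩
  obtain ⟨e, he⟩ : ∃ e : Fin (n + 1) ≃ V, ∀ i j, key (e i) < key (e j) ↔ j < i := by
    let _ : LinearOrder V := LinearOrder.lift' (fun x => OrderDual.toDual (key x))
      fun x y hxy => hkey (OrderDual.toDual.injective hxy)
    let e := Fintype.orderIsoFinOfCardEq V hn
    refine ⟨e.toEquiv, fun i j => ?_⟩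
    rw [← e.lt_iff_lt]
    rfl
  -- the indices of the elements of `A (e i)`
  let B : Fin (n + 1) → Finset (Fin (n + 1)) := fun i => (A (e i)).map e.symm.toEmbedding
  have hB : ∀ i j, j ∈ B i ↔ e j ∈ A (e i) := fun i j => by
    simp only [B, Finset.mem_map_equiv, Equiv.symm_symm]
  have hlt : ∀ i, ∀ j ∈ B i, j < i := fun i j hj => (he i j).1 (hA _ _ ((hB i j).1 hj))
  let p : Fin (n + 1) → Fin (n + 1) := fun i => if h : (B i).Nonempty then (B i).max' h else 0
  have hp : ∀ i, i ≠ 0 → p i < i := by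
    intro i hi
    by_cases h : (B i).Nonempty
    · simp only [p, dif_pos h]
      exact hlt i _ (Finset.max'_mem _ h)
    · simp only [p, dif_neg h]
      exact Fin.pos_of_ne_zero hi
  have htree := isTree_fromRel_parent p hp
  refine ⟨Fin (n + 1), inferInstance,
    { tree := SimpleGraph.fromRel fun i j => i ≠ 0 ∧ p i = j
      isTree := htree
      bag := fun i => insert (e i) (A (e i) ∪ S)
      vertex_mem := fun v => ⟨e.symm v, by simp⟩
      edge_mem := ?_
      connected := ?_ }, ?_⟩
  · intro u v huv
    rcases hadj u v huv with h | h | h | h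
    · exact ⟨e.symm v, by simp [h], by simp⟩
    · exact ⟨e.symm u, by simp, by simp [h]⟩
    · exact ⟨e.symm v, by simp [h], by simp⟩
    · exact ⟨e.symm u, by simp, by simp [h]⟩
  · intro v
    rw [SimpleGraph.connected_iff_exists_forall_reachable]
    by_cases hv : v ∈ S
    · have huniv : {i | v ∈ insert (e i) (A (e i) ∪ S)} = Set.univ := by
        ext i; simp [hv]
      rw [huniv]
      refine ⟨⟨0, trivial⟩, fun w => ?_⟩
      exact (SimpleGraph.Iso.reachable_iff (φ := SimpleGraph.induceUnivIso _)).1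
        (htree.connected.preconnected 0 w.1)
    · obtain ⟨j, rfl⟩ := e.surjective v
      have hmem : ∀ i, e j ∈ insert (e i) (A (e i) ∪ S) ↔ j = i ∨ j ∈ B i := by
        intro i
        rw [hB]
        simp [hv]
      refine ⟨⟨j, by simp⟩, ?_⟩
      rintro ⟨i, hi⟩
      induction i using WellFoundedLT.induction with
      | ind i ih =>
        rcases (hmem i).1 hi with rfl | hj
        · exact SimpleGraph.Reachable.refl _
        · have hne : (B i).Nonempty := ⟨j, hj⟩
          have hpi : p i = (B i).max' hne := dif_pos hne
          have hpB : p i ∈ B i := hpi ▸ Finset.max'_mem _ hne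
          have hi0 : i ≠ 0 := fun h => by
            have := hlt i j hj
            rw [h] at this
            exact absurd this (Fin.not_lt_zero j)
          have hpm : e j ∈ insert (e (p i)) (A (e (p i)) ∪ S) := by
            rw [hmem]
            rcases (hpi ▸ Finset.le_max' _ _ hj : j ≤ p i).eq_or_lt with h | h
            · exact Or.inl h
            · exact Or.inr ((hB _ _).2 (hclique _ _ ((hB i j).1 hj) _ ((hB i _).1 hpB)
                ((he _ _).2 h)))
          refine (ih (p i) (hp i hi0) hpm).trans (SimpleGraph.Adj.reachable ?_)
          rw [SimpleGraph.induce_adj, SimpleGraph.fromRel_adj]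
          exact ⟨(hp i hi0).ne, Or.inr ⟨hi0, rfl⟩⟩
  · intro i
    refine (Finset.card_insert_le _ _).trans (Nat.succ_le_succ ?_)
    exact (Finset.card_union_le _ _).trans (hcard _)

theorem treewidth_le {V : Type*} {G : SimpleGraph V} {k : ℕ} (h : HasTreewidthLE G k) :
    treewidth G ≤ k :=
  Nat.sInf_le h

/-! ### Shortest-path distances -/

theorem List.Sublist.sum_le_sum_of_nonneg {l l' : List ℝ} (h : l.Sublist l')
    (hl : ∀ a ∈ l', 0 ≤ a) : l.sum ≤ l'.sum := by
  induction h with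
  | slnil => exact le_rfl
  | cons a _ ih =>
    rw [List.sum_cons]
    have h1 := ih fun b hb => hl b (List.mem_cons_of_mem _ hb)
    have h2 := hl a List.mem_cons_self
    linarith
  | cons_cons a _ ih =>
    rw [List.sum_cons, List.sum_cons]
    have h1 := ih fun b hb => hl b (List.mem_cons_of_mem _ hb)
    linarith

namespace LengthGraph

variable {V : Type*} (G : LengthGraph V)

theorem walkLength_nonneg {u v : V} (p : G.graph.Walk u v) : 0 ≤ G.walkLength p := by
  refine List.sum_nonneg ?_
  simp only [List.mem_map, forall_exists_index, and_imp]
  rintro _ e he rfl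
  exact (G.len_pos e (p.edges_subset_edgeSet he)).le

theorem walkLength_bypass_le [DecidableEq V] {u v : V} (p : G.graph.Walk u v) :
    G.walkLength p.bypass ≤ G.walkLength p := by
  refine (p.edges_bypass_sublist_edges.map G.len).sum_le_sum_of_nonneg ?_
  simp only [List.mem_map, forall_exists_index, and_imp]
  rintro _ e he rfl
  exact (G.len_pos e (p.edges_subset_edgeSet he)).le

theorem walkLength_append {u v w : V} (p : G.graph.Walk u v) (q : G.graph.Walk v w) :
    G.walkLength (p.append q) = G.walkLength p + G.walkLength q := by
  simp [walkLength]

theorem walkLength_reverse {u v : V} (p : G.graph.Walk u v) :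
    G.walkLength p.reverse = G.walkLength p := by
  simp [walkLength]

theorem dist_le_walkLength {u v : V} (p : G.graph.Walk u v) : G.dist u v ≤ G.walkLength p :=
  ciInf_le ⟨0, by rintro _ ⟨q, rfl⟩; exact G.walkLength_nonneg q⟩ p

theorem dist_nonneg (u v : V) : 0 ≤ G.dist u v :=
  Real.iInf_nonneg fun p => G.walkLength_nonneg p

theorem dist_self (v : V) : G.dist v v = 0 :=
  le_antisymm (G.dist_le_walkLength SimpleGraph.Walk.nil) (G.dist_nonneg v v)

theorem dist_le_len {u v : V} (h : G.graph.Adj u v) : G.dist u v ≤ G.len s(u, v) := by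
  simpa [walkLength] using G.dist_le_walkLength h.toWalk

theorem le_walkLength_of_forall_adj (d : V → V → ℝ) (hself : ∀ v, d v v = 0)
    (htri : ∀ u v w, d u w ≤ d u v + d v w) (hadj : ∀ u v, G.graph.Adj u v → d u v ≤ G.len s(u, v))
    {u v : V} (p : G.graph.Walk u v) : d u v ≤ G.walkLength p := by
  induction p with
  | nil => simp [walkLength, hself]
  | @cons u v w h p ih =>
    have h1 := htri u v w
    have h2 := hadj u v h
    have h3 : G.walkLength (SimpleGraph.Walk.cons h p) = G.len s(u, v) + G.walkLength p := by
      simp [walkLength]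
    linarith

variable {G}

theorem exists_isShortestPath [Finite V] (hG : G.graph.Connected) (u v : V) :
    ∃ p : G.graph.Walk u v, G.IsShortestPath p := by
  classical
  have : Fintype V := Fintype.ofFinite V
  have hfin : {p : G.graph.Walk u v | p.IsPath}.Finite := by
    refine (Set.toFinite {p : G.graph.Walk u v | p.length < Fintype.card V}).subset ?_
    exact fun p hp => SimpleGraph.Walk.IsPath.length_lt hp
  obtain ⟨q⟩ := hG.preconnected u v
  obtain ⟨p, hp, hmin⟩ := Set.exists_min_image _ G.walkLength hfin ⟨q.bypass, q.bypass_isPath⟩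
  have : Nonempty (G.graph.Walk u v) := ⟨q⟩
  refine ⟨p, hp, le_antisymm (le_ciInf fun w => ?_) (G.dist_le_walkLength p)⟩
  exact (hmin _ w.bypass_isPath).trans (G.walkLength_bypass_le w)

theorem dist_comm (u v : V) : G.dist u v = G.dist v u := by
  refine Equiv.iInf_congr ⟨SimpleGraph.Walk.reverse, SimpleGraph.Walk.reverse,
    fun p => p.reverse_reverse, fun p => p.reverse_reverse⟩ fun p => ?_
  exact G.walkLength_reverse p

theorem dist_triangle [Finite V] (hG : G.graph.Connected) (u v w : V) :
    G.dist u w ≤ G.dist u v + G.dist v w := by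
  obtain ⟨p, -, hp⟩ := exists_isShortestPath hG u v
  obtain ⟨q, -, hq⟩ := exists_isShortestPath hG v w
  rw [← hp, ← hq, ← walkLength_append]
  exact G.dist_le_walkLength _

theorem dist_pos [Finite V] (hG : G.graph.Connected) {u v : V} (huv : u ≠ v) :
    0 < G.dist u v := by
  obtain ⟨p, -, hp⟩ := exists_isShortestPath hG u v
  rw [← hp]
  cases p with
  | nil => exact absurd rfl huv
  | cons h p =>
    have h1 := G.len_pos _ ((SimpleGraph.mem_edgeSet _).2 h)
    have h2 := G.walkLength_nonneg p
    simp only [walkLength, SimpleGraph.Walk.edges_cons, List.map_cons, List.sum_cons] at h2 ⊢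
    linarith

/-- Distances add up along a shortest path. -/
theorem IsShortestPath.dist_add_dist [Finite V] (hG : G.graph.Connected) {u v w : V}
    {p : G.graph.Walk u v} (hp : G.IsShortestPath p) (hw : w ∈ p.support) :
    G.dist u w + G.dist w v = G.dist u v := by
  classical
  refine le_antisymm ?_ (dist_triangle hG u w v)
  rw [← hp.2, ← congrArg G.walkLength (p.take_spec hw), walkLength_append]
  exact add_le_add (G.dist_le_walkLength _) (G.dist_le_walkLength _)

theorem distSet_nonneg (S : Finset V) (hS : S.Nonempty) (v : V) : 0 ≤ G.distSet S hS v :=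
  Finset.le_inf' _ _ fun _ _ => G.dist_nonneg _ _

theorem exists_mem_dist_eq_distSet (S : Finset V) (hS : S.Nonempty) (v : V) :
    ∃ s ∈ S, G.dist s v = G.distSet S hS v := by
  obtain ⟨s, hs, h⟩ := Finset.exists_mem_eq_inf' hS fun s => G.dist s v
  exact ⟨s, hs, h.symm⟩

theorem distSet_le_add [Finite V] (hG : G.graph.Connected) (S : Finset V) (hS : S.Nonempty)
    (u v : V) : G.distSet S hS v ≤ G.distSet S hS u + G.dist u v := by
  obtain ⟨s, hs, h⟩ := G.exists_mem_dist_eq_distSet S hS u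
  rw [← h]
  exact (Finset.inf'_le _ hs).trans (dist_triangle hG s u v)

theorem distSet_pos [Finite V] (hG : G.graph.Connected) (S : Finset V) (hS : S.Nonempty) {v : V}
    (hv : v ∉ S) : 0 < G.distSet S hS v := by
  obtain ⟨s, hs, h⟩ := G.exists_mem_dist_eq_distSet S hS v
  rw [← h]
  exact dist_pos hG fun hsv => hv (hsv ▸ hs)

end LengthGraph

namespace LengthGraph

variable {V : Type*} {G : LengthGraph V}

/-! ### Towns and their classes -/

/-- A town of scale `ρ`: a cluster of vertices at mutual distances less than `ρ` whose distance
from all other vertices is at least `ρ`. -/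
def IsTown (G : LengthGraph V) (ρ : ℝ) (T : Set V) : Prop :=
  (∀ y ∈ T, ∀ z ∈ T, G.dist y z < ρ) ∧ ∀ y ∈ T, ∀ z ∉ T, ρ ≤ G.dist y z

/-- The vertices that no town of scale at least `r` separates from `x`. -/
def townClass (G : LengthGraph V) (r : ℝ) (x : V) : Set V :=
  {y | ∀ (T : Set V) (ρ : ℝ), r ≤ ρ → G.IsTown ρ T → (x ∈ T ↔ y ∈ T)}

theorem mem_townClass_self (r : ℝ) (x : V) : x ∈ G.townClass r x := fun _ _ _ _ => Iff.rfl

theorem mem_townClass_symm {r : ℝ} {x y : V} (h : y ∈ G.townClass r x) : x ∈ G.townClass r y :=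
  fun T ρ hρ hT => (h T ρ hρ hT).symm

theorem mem_townClass_trans {r : ℝ} {x y z : V} (hxy : y ∈ G.townClass r x)
    (hyz : z ∈ G.townClass r y) : z ∈ G.townClass r x :=
  fun T ρ hρ hT => (hxy T ρ hρ hT).trans (hyz T ρ hρ hT)

theorem townClass_antitone {r r' : ℝ} (h : r ≤ r') (x : V) :
    G.townClass r x ⊆ G.townClass r' x :=
  fun _ hy T ρ hρ hT => hy T ρ (h.trans hρ) hT

theorem townClass_eq {r : ℝ} {x y : V} (h : y ∈ G.townClass r x) :
    G.townClass r x = G.townClass r y :=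
  Set.ext fun _ => ⟨fun hz => mem_townClass_trans (mem_townClass_symm h) hz,
    fun hz => mem_townClass_trans h hz⟩

/-- Vertices at distance less than `r` are not separated by a town of scale at least `r`. -/
theorem mem_townClass_of_dist_lt {r : ℝ} {x y : V} (h : G.dist x y < r) :
    y ∈ G.townClass r x := by
  intro T ρ hρ hT
  constructor <;> intro hx <;> by_contra hy
  · linarith [hT.2 x hx y hy]
  · have := hT.2 y hx x hy
    rw [dist_comm] at this
    linarith

/-- If the set `Q` meets every shortest path of length at least `ρ` in the ball `B_p(cρ)`, then
the vertices that are close to a vertex `x` far from `Q` form a town. Any shortest path of length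
at least `ρ` near `x` would contain a vertex of `Q` near `x`. -/
theorem isTown_of_far [Finite V] (hG : G.graph.Connected) {c ρ : ℝ} {p x : V} {Q : Finset V}
    (hQ : ∀ (a b : V) (w : G.graph.Walk a b), G.IsShortestPath w →
      (∀ v ∈ w.support, v ∈ G.ball p (c * ρ)) → ρ ≤ G.walkLength w → ∃ v ∈ w.support, v ∈ Q)
    (hpx : G.dist p x ≤ (c - 2) * ρ) (hfar : ∀ q ∈ Q, 2 * ρ < G.dist q x) :
    G.IsTown ρ {y | G.dist x y < ρ} := by
  have key : ∀ a b : V, (∀ v, G.dist a v + G.dist v b = G.dist a b → G.dist x v ≤ 2 * ρ) →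
      G.dist a b < ρ := by
    intro a b hv
    by_contra! hab
    obtain ⟨w, hw⟩ := exists_isShortestPath hG a b
    have hnear : ∀ v ∈ w.support, G.dist x v ≤ 2 * ρ := fun v h => hv v (hw.dist_add_dist hG h)
    obtain ⟨v, hvw, hvQ⟩ := hQ a b w hw (fun v h => by
      have h1 := hnear v h
      have h2 := dist_triangle hG p x v
      change G.dist p v ≤ c * ρ
      linarith) (hw.2 ▸ hab)
    have h1 := hnear v hvw
    have h2 := hfar v hvQ
    rw [dist_comm] at h2
    linarith
  constructor
  · intro y hy z hz
    simp only [Set.mem_ofPred_eq] at hy hz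
    refine key y z fun v hv => ?_
    have h1 := dist_triangle hG y x z
    have h2 := dist_triangle hG x y v
    have h3 := dist_triangle hG x z v
    rw [dist_comm y x] at h1
    rw [dist_comm z v] at h3
    linarith
  · intro y hy z hz
    simp only [Set.mem_ofPred_eq] at hy hz
    by_contra! hyz
    have h1 := dist_triangle hG x y z
    refine hz (key x z fun v hv => ?_)
    have h2 := G.dist_nonneg v z
    linarith

/-! ### Hubs in a town class -/

/-- A cover of radius `2rμ^i` of a part of a town class, where `μ = (c - 2)/2`, can be refined to a
cover of radius `2r`: in each of `i` rounds, a cover by balls of radius `(c - 2)ρ` is replaced by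
the balls of radius `2ρ` around the hubs of scale `ρ`, or by one such ball if a vertex far from
the hubs lies in a town of scale `ρ`, since this town contains the whole class. As `c > 4`, the
radii decrease. -/
theorem exists_refined_cover [Finite V] (hG : G.graph.Connected) {c : ℝ} (hc : 4 < c) {η : ℕ}
    (hη : G.HasHighwayDimLE c η) {r : ℝ} (hr : 0 < r) {z : V} {X : Set V}
    (hX : X ⊆ G.townClass r z) (i : ℕ) (P : Finset V) (hP : P.Nonempty)
    (hcov : ∀ x ∈ X, ∃ p ∈ P, G.dist p x ≤ 2 * r * ((c - 2) / 2) ^ i) :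
    ∃ P' : Finset V, P'.card ≤ P.card * (η + 1) ^ i ∧ ∀ x ∈ X, ∃ p ∈ P', G.dist p x ≤ 2 * r := by
  classical
  induction i generalizing P with
  | zero => exact ⟨P, by simp, by simpa using hcov⟩
  | succ i ih =>
    set ρ := r * ((c - 2) / 2) ^ i with hρ
    have hμ : 1 ≤ ((c - 2) / 2) ^ i := one_le_pow₀ (by linarith)
    have hrρ : r ≤ ρ := le_mul_of_one_le_right hr.le hμ
    have hR : 2 * r * ((c - 2) / 2) ^ (i + 1) = (c - 2) * ρ := by rw [hρ, pow_succ]; ring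
    have hR' : 2 * r * ((c - 2) / 2) ^ i = 2 * ρ := by rw [hρ]; ring
    rw [hR] at hcov
    rw [hR'] at ih
    choose Q _ hQcard hQ using hη ρ (hr.trans_le hrρ)
    have hPpos := hP.card_pos
    by_cases hall : ∀ x ∈ X, ∃ p ∈ P, ∃ q ∈ Q p, G.dist q x ≤ 2 * ρ
    · by_cases hne : (P.biUnion Q).Nonempty
      · obtain ⟨P', hcard, hP'⟩ := ih (P.biUnion Q) hne fun x hx => by
          obtain ⟨p, hp, q, hq, h⟩ := hall x hx
          exact ⟨q, Finset.mem_biUnion.2 ⟨p, hp, hq⟩, h⟩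
        refine ⟨P', hcard.trans ?_, hP'⟩
        have h1 : (P.biUnion Q).card ≤ P.card * η :=
          Finset.card_biUnion_le_card_mul _ _ _ fun p _ => hQcard p
        calc (P.biUnion Q).card * (η + 1) ^ i ≤ (P.card * (η + 1)) * (η + 1) ^ i :=
              Nat.mul_le_mul_right _ (h1.trans (Nat.mul_le_mul_left _ (Nat.le_succ _)))
          _ = P.card * (η + 1) ^ (i + 1) := by ring
      · refine ⟨∅, by simp, fun x hx => ?_⟩
        obtain ⟨p, hp, q, hq, -⟩ := hall x hx
        exact absurd ⟨q, Finset.mem_biUnion.2 ⟨p, hp, hq⟩⟩ hne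
    · push Not at hall
      obtain ⟨x, hx, hfar⟩ := hall
      obtain ⟨p, hp, hpx⟩ := hcov x hx
      have hT := isTown_of_far hG (hQ p) hpx (hfar p hp)
      obtain ⟨P', hcard, hP'⟩ := ih {x} (Finset.singleton_nonempty x) fun y hy => by
        have hxy := mem_townClass_trans (mem_townClass_symm (hX hx)) (hX hy)
        have hself : x ∈ {y | G.dist x y < ρ} := by
          simpa [dist_self] using hr.trans_le hrρ
        have : G.dist x y < ρ := (hxy _ ρ hrρ hT).1 hself
        exact ⟨x, Finset.mem_singleton_self x, by linarith⟩
      refine ⟨P', hcard.trans ?_, hP'⟩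
      rw [Finset.card_singleton]
      exact Nat.mul_le_mul hPpos (Nat.pow_le_pow_right (Nat.succ_pos η) (Nat.le_succ i))

/-- Each town class of scale `r` contains a bounded number of hubs that serve its vertices at
distance at most `E r` from `S`: they meet all shortest paths from such vertices with length in
`[4r/c, r)`, and they come within `4r` of every such vertex. -/
theorem exists_hubs [Finite V] (hG : G.graph.Connected) {c : ℝ} (hc : 4 < c) {η : ℕ}
    (hη : G.HasHighwayDimLE c η) (S : Finset V) (hS : S.Nonempty) {E : ℝ} {J : ℕ}
    (hJ : E ≤ 2 * ((c - 2) / 2) ^ J) {r : ℝ} (hr : 0 < r) (z : V) :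
    ∃ N : Finset V, N.card ≤ S.card * (η + 1) ^ (J + 1) ∧ (∀ h ∈ N, h ∈ G.townClass r z) ∧
      (∀ x ∈ G.townClass r z, G.distSet S hS x ≤ E * r → ∀ y, 4 * r / c ≤ G.dist x y →
        G.dist x y < r → ∃ h ∈ N, G.dist x h + G.dist h y = G.dist x y) ∧
      (∀ x ∈ G.townClass r z, G.distSet S hS x ≤ E * r →
        ∃ h ∈ N, G.distSet S hS h ≤ E * r ∧ G.dist x h ≤ 4 * r) := by
  classical
  set X : Set V := {x | x ∈ G.townClass r z ∧ G.distSet S hS x ≤ E * r} with hX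
  obtain ⟨P, hPcard, hP⟩ := exists_refined_cover hG hc hη hr (X := X) (fun x hx => hx.1) J S hS
    fun x hx => by
      obtain ⟨s, hs, h⟩ := G.exists_mem_dist_eq_distSet S hS x
      refine ⟨s, hs, ?_⟩
      rw [h]
      have := mul_le_mul_of_nonneg_right hJ hr.le
      linarith [hx.2]
  have hρ : 0 < 4 * r / c := by positivity
  have hcρ : c * (4 * r / c) = 4 * r := by field_simp
  choose Q _ hQcard hQ using hη (4 * r / c) hρ
  rw [hcρ] at hQ
  -- replace each centre of the cover by a nearby vertex of `X`
  let g : V → V := fun p => if h : ∃ x ∈ X, G.dist p x ≤ 2 * r then h.choose else p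
  have hg : ∀ p, ∀ x ∈ X, G.dist p x ≤ 2 * r → g p ∈ X ∧ G.dist p (g p) ≤ 2 * r := by
    intro p x hx hpx
    have h : ∃ x ∈ X, G.dist p x ≤ 2 * r := ⟨x, hx, hpx⟩
    simp only [g, dif_pos h]
    exact h.choose_spec
  refine ⟨(P.biUnion Q ∪ P.image g).filter fun h => h ∈ G.townClass r z, ?_, ?_, ?_, ?_⟩
  · refine (Finset.card_filter_le _ _).trans ((Finset.card_union_le _ _).trans ?_)
    have h1 : (P.biUnion Q).card ≤ P.card * η :=
      Finset.card_biUnion_le_card_mul _ _ _ fun p _ => hQcard p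
    have h2 : (P.image g).card ≤ P.card := Finset.card_image_le
    calc (P.biUnion Q).card + (P.image g).card ≤ P.card * (η + 1) := by rw [mul_add_one]; omega
      _ ≤ (S.card * (η + 1) ^ J) * (η + 1) := Nat.mul_le_mul_right _ hPcard
      _ = S.card * (η + 1) ^ (J + 1) := by ring
  · intro h hh
    exact (Finset.mem_filter.1 hh).2
  · intro x hxz hxE y hxy hxyr
    obtain ⟨p, hp, hpx⟩ := hP x ⟨hxz, hxE⟩
    obtain ⟨w, hw⟩ := exists_isShortestPath hG x y
    obtain ⟨h, hhw, hhQ⟩ := hQ p x y w hw (fun v hv => by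
      have h1 := dist_triangle hG p x v
      have h2 := hw.dist_add_dist hG hv
      have h3 := G.dist_nonneg v y
      change G.dist p v ≤ 4 * r
      linarith) (hw.2 ▸ hxy)
    have hadd := hw.dist_add_dist hG hhw
    refine ⟨h, ?_, hadd⟩
    have hlt : G.dist x h < r := by linarith [G.dist_nonneg h y]
    simp only [Finset.mem_filter, Finset.mem_union, Finset.mem_biUnion]
    exact ⟨Or.inl ⟨p, hp, hhQ⟩, mem_townClass_trans hxz (mem_townClass_of_dist_lt hlt)⟩
  · intro x hxz hxE
    obtain ⟨p, hp, hpx⟩ := hP x ⟨hxz, hxE⟩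
    obtain ⟨hgX, hgp⟩ := hg p x ⟨hxz, hxE⟩ hpx
    refine ⟨g p, ?_, hgX.2, ?_⟩
    · simp only [Finset.mem_filter, Finset.mem_union]
      exact ⟨Or.inr (Finset.mem_image_of_mem g hp), hgX.1⟩
    · have h1 := dist_triangle hG x p (g p)
      rw [dist_comm x p] at h1
      linarith

end LengthGraph

namespace LengthGraph

variable {V : Type*} {G : LengthGraph V}

/-! ### The hub graph -/

/-- The graph `Γ` with each edge given the distance in `G` of its end points as its length. -/
noncomputable def metricOn [Finite V] (G : LengthGraph V) (hG : G.graph.Connected)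
    (Γ : SimpleGraph V) : LengthGraph V where
  graph := Γ
  len := Sym2.lift ⟨G.dist, dist_comm⟩
  len_pos := by
    intro e
    induction e with
    | h x y => exact fun h => dist_pos hG ((SimpleGraph.mem_edgeSet _).1 h).ne

theorem dist_le_metricOn_dist [Finite V] (hG : G.graph.Connected) {Γ : SimpleGraph V}
    (hΓ : Γ.Connected) (x y : V) : G.dist x y ≤ (G.metricOn hG Γ).dist x y := by
  have : Nonempty ((G.metricOn hG Γ).graph.Walk x y) := hΓ.preconnected x y
  exact le_ciInf fun p => le_walkLength_of_forall_adj (G.metricOn hG Γ) G.dist G.dist_self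
    (dist_triangle hG) (fun _ _ _ => le_rfl) p

theorem metricOn_dist_le [Finite V] (hG : G.graph.Connected) {Γ : SimpleGraph V} {x y : V}
    (h : x ≠ y → Γ.Adj x y) : (G.metricOn hG Γ).dist x y ≤ G.dist x y := by
  by_cases hxy : x = y
  · rw [hxy, dist_self, dist_self]
  · exact (G.metricOn hG Γ).dist_le_len (h hxy)

/-- The graph in which the vertices of `S` are joined to all vertices, and `x` is joined to a hub
`y` if the level of `y` exceeds that of `x` by at most `m`, and no town at the scale of `y`
separates them. A vertex of level `ℓ` has scale `lam ^ ℓ`. -/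
def hubGraph (G : LengthGraph V) (lam : ℝ) (S : Finset V) (hub : Set V) (lev : V → ℤ) (m : ℕ) :
    SimpleGraph V :=
  SimpleGraph.fromRel fun x y => x ∈ S ∨
    y ∈ hub ∧ lev x ≤ lev y ∧ lev y ≤ lev x + m ∧ x ∈ G.townClass (lam ^ lev y) y

theorem hubGraph_connected {lam : ℝ} {S : Finset V} (hS : S.Nonempty) {hub : Set V}
    {lev : V → ℤ} {m : ℕ} : (G.hubGraph lam S hub lev m).Connected := by
  obtain ⟨s, hs⟩ := hS
  refine (SimpleGraph.connected_iff_exists_forall_reachable _).2 ⟨s, fun x => ?_⟩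
  by_cases hx : s = x
  · rw [hx]
  · exact ((SimpleGraph.fromRel_adj _ _ _).2 ⟨hx, Or.inl (Or.inl hs)⟩).reachable

/-- If each town class contains at most `M` hubs of its own level, then the hub graph has small
treewidth: eliminate the vertices by increasing level. Since the town classes grow with the level,
any two hubs adjacent to `x` that are eliminated after `x` are compatible with one another. -/
theorem hasTreewidthLE_hubGraph [Finite V] [Nonempty V] {lam : ℝ} (hlam : 1 ≤ lam)
    {S : Finset V} {hub : Set V} {lev : V → ℤ} {m M : ℕ}
    (hM : ∀ (ℓ : ℤ) (x : V), ∃ N : Finset V, N.card ≤ M ∧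
      ∀ a ∈ hub, lev a = ℓ → a ∈ G.townClass (lam ^ ℓ) x → a ∈ N) :
    HasTreewidthLE (G.hubGraph lam S hub lev m) (S.card + (m + 1) * M) := by
  classical
  have : Fintype V := Fintype.ofFinite V
  -- at equal levels, hubs come after the other vertices
  let key : V → ℤ ×ₗ Fin (Fintype.card V) := fun x =>
    toLex (2 * lev x + if x ∈ hub then 1 else 0, Fintype.equivFin V x)
  have hkey : Function.Injective key := fun x y h =>
    (Fintype.equivFin V).injective (congrArg (fun z => (ofLex z).2) h)
  have hlev : ∀ x y, key x < key y → lev x ≤ lev y := by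
    intro x y h
    rcases Prod.Lex.toLex_lt_toLex.1 h with h | ⟨h, -⟩
    · simp only at h
      split_ifs at h <;> omega
    · simp only at h
      split_ifs at h <;> omega
  have hcomp : ∀ x y, x ≠ y → y ∈ hub → lev x ≤ lev y → key x < key y ∨
      x ∈ hub ∧ lev x = lev y ∧ key y < key x := by
    intro x y hne hy hl
    rcases lt_or_gt_of_ne (hkey.ne hne) with h | h
    · exact Or.inl h
    · refine Or.inr ⟨?_, le_antisymm hl (hlev _ _ h), h⟩
      by_contra hx
      refine absurd h (not_lt.2 (Prod.Lex.toLex_lt_toLex.2 (Or.inl ?_)).le)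
      simp only [hx, hy, if_true, if_false]
      omega
  let A : V → Finset V := fun x => Finset.univ.filter fun a =>
    a ∈ hub ∧ key x < key a ∧ lev a ≤ lev x + m ∧ x ∈ G.townClass (lam ^ lev a) a
  have hA : ∀ x a, a ∈ A x ↔
      a ∈ hub ∧ key x < key a ∧ lev a ≤ lev x + m ∧ x ∈ G.townClass (lam ^ lev a) a := by
    simp [A]
  have hrel : ∀ x y, x ≠ y → (x ∈ S ∨ y ∈ hub ∧ lev x ≤ lev y ∧ lev y ≤ lev x + m ∧
      x ∈ G.townClass (lam ^ lev y) y) → x ∈ S ∨ x ∈ A y ∨ y ∈ A x := by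
    rintro x y hne (h | ⟨hy, hl, hm, hc⟩)
    · exact Or.inl h
    · right
      rcases hcomp x y hne hy hl with h | ⟨hx, heq, h⟩
      · exact Or.inr ((hA _ _).2 ⟨hy, h, hm, hc⟩)
      · refine Or.inl ((hA _ _).2 ⟨hx, h, by omega, ?_⟩)
        rw [heq]
        exact mem_townClass_symm hc
  refine hasTreewidthLE_of_elimination _ key hkey A S _ (fun x a ha => ((hA x a).1 ha).2.1) ?_ ?_ ?_
  · intro x a ha b hb hba
    obtain ⟨hah, -, ham, hac⟩ := (hA x a).1 ha
    obtain ⟨-, hxb, -, hbc⟩ := (hA x b).1 hb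
    refine (hA b a).2 ⟨hah, hba, by linarith [hlev x b hxb], ?_⟩
    exact mem_townClass_trans hac (townClass_antitone (zpow_le_zpow_right₀ hlam (hlev b a hba)) _
      (mem_townClass_symm hbc))
  · intro x y h
    obtain ⟨hne, h | h⟩ := (SimpleGraph.fromRel_adj _ _ _).1 h
    · rcases hrel x y hne h with h | h | h <;> simp [h]
    · rcases hrel y x hne.symm h with h | h | h <;> simp [h]
  · intro x
    choose N hNcard hN using fun ℓ => hM ℓ x
    have hsub : A x ⊆ (Finset.Icc (lev x) (lev x + m)).biUnion N := by
      intro a ha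
      obtain ⟨hah, hxa, ham, hac⟩ := (hA x a).1 ha
      exact Finset.mem_biUnion.2 ⟨lev a, Finset.mem_Icc.2 ⟨hlev x a hxa, ham⟩,
        hN _ a hah rfl (mem_townClass_symm hac)⟩
    have h1 := (Finset.card_le_card hsub).trans
      (Finset.card_biUnion_le_card_mul _ _ M fun ℓ _ => hNcard ℓ)
    have h2 : (Finset.Icc (lev x) (lev x + m)).card = m + 1 := by
      rw [Int.card_Icc]
      omega
    rw [h2] at h1
    omega

/-! ### The embedding -/

/-- A single choice of hubs for every town class of every scale `lam ^ ℓ`. -/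
theorem exists_hub_family [Finite V] (hG : G.graph.Connected) {c : ℝ} (hc : 4 < c) {η : ℕ}
    (hη : G.HasHighwayDimLE c η) (S : Finset V) (hS : S.Nonempty) {E : ℝ} {J : ℕ}
    (hJ : E ≤ 2 * ((c - 2) / 2) ^ J) {lam : ℝ} (hlam : 0 < lam) :
    ∃ N : ℤ → Set V → Finset V, ∀ (ℓ : ℤ) (z : V),
      (N ℓ (G.townClass (lam ^ ℓ) z)).card ≤ S.card * (η + 1) ^ (J + 1) ∧
      (∀ h ∈ N ℓ (G.townClass (lam ^ ℓ) z), h ∈ G.townClass (lam ^ ℓ) z) ∧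
      (∀ x ∈ G.townClass (lam ^ ℓ) z, G.distSet S hS x ≤ E * lam ^ ℓ →
        ∀ y, 4 * lam ^ ℓ / c ≤ G.dist x y → G.dist x y < lam ^ ℓ →
          ∃ h ∈ N ℓ (G.townClass (lam ^ ℓ) z), G.dist x h + G.dist h y = G.dist x y) ∧
      (∀ x ∈ G.townClass (lam ^ ℓ) z, G.distSet S hS x ≤ E * lam ^ ℓ →
        ∃ h ∈ N ℓ (G.townClass (lam ^ ℓ) z), G.distSet S hS h ≤ E * lam ^ ℓ ∧
          G.dist x h ≤ 4 * lam ^ ℓ) := by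
  choose N hN using fun (ℓ : ℤ) (z : V) => exists_hubs hG hc hη S hS hJ (zpow_pos hlam ℓ) z
  classical
  refine ⟨fun ℓ C => if h : ∃ z, G.townClass (lam ^ ℓ) z = C then N ℓ h.choose else ∅,
    fun ℓ z => ?_⟩
  have h : ∃ z', G.townClass (lam ^ ℓ) z' = G.townClass (lam ^ ℓ) z := ⟨z, rfl⟩
  have key := hN ℓ h.choose
  rw [h.choose_spec] at key
  simpa only [dif_pos h] using key

/-- The embedding for a fixed `ε`: the numbers `J` of refinement rounds and `m` of relevant levels
depend only on `c` and `ε`. -/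
theorem exists_low_treewidth_approximation {c : ℝ} (hc : 4 < c) {ε : ℝ} (hε : 0 < ε) :
    ∃ J m : ℕ, ∀ (V : Type*) [Finite V] (G : LengthGraph V) (η : ℕ), G.graph.Connected →
      G.HasHighwayDimLE c η → ∀ (S : Finset V) (hS : S.Nonempty), ∃ H : LengthGraph V,
        H.graph.Connected ∧
        HasTreewidthLE H.graph (S.card + (m + 1) * (S.card * (η + 1) ^ (J + 1))) ∧
        ∀ u v : V, G.dist u v ≤ H.dist u v ∧
          H.dist u v ≤ (1 + ε) * G.dist u v + ε * min (G.distSet S hS u) (G.distSet S hS v) := by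
  obtain ⟨lam, hlamc⟩ : ∃ lam, lam = c / 4 := ⟨_, rfl⟩
  have hlam : 1 < lam := by rw [hlamc]; linarith
  have hlam0 : 0 < lam := by linarith
  -- pairs with `d ≤ δ D` or `D ≤ δ d`, where `D` is the distance from `S`, need no exact hub
  obtain ⟨δ, hδ0, hδε, hδ1⟩ : ∃ δ : ℝ, 0 < δ ∧ 8 * lam * δ ≤ ε ∧ 8 * lam * δ ≤ 1 := by
    refine ⟨min ε 1 / (8 * lam), by positivity, ?_, ?_⟩
    · rw [mul_div_cancel₀ _ (by positivity)]
      exact min_le_left _ _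
    · rw [mul_div_cancel₀ _ (by positivity)]
      exact min_le_right _ _
  have hδ8 : 8 * δ ≤ 1 := by nlinarith
  obtain ⟨E, hE⟩ : ∃ E, E = 1 / δ := ⟨_, rfl⟩
  have hEδ : E * δ = 1 := by rw [hE]; field_simp
  have hE8 : 8 ≤ E := by
    rw [hE, le_div_iff₀ hδ0]
    exact hδ8
  -- comparable vertices have distances from `S` within the factor `K`
  obtain ⟨K, hK⟩ : ∃ K, K = 2 * E ^ 2 := ⟨_, rfl⟩
  have hK4 : 4 ≤ K := by nlinarith
  have hKE : E + 1 ≤ K := by nlinarith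
  have hKEE : (E + 1) * E ≤ K := by nlinarith
  obtain ⟨B, hB⟩ : ∃ B, B = lam * (K * (E + 1)) := ⟨_, rfl⟩
  have hKE1 : E + 1 ≤ K * (E + 1) := by nlinarith
  have hB0 : E + 1 ≤ B := by rw [hB]; nlinarith
  obtain ⟨J, hJ'⟩ := pow_unbounded_of_one_lt E (show 1 < (c - 2) / 2 by linarith)
  have hJ : E ≤ 2 * ((c - 2) / 2) ^ J := by linarith
  obtain ⟨m, hm⟩ := pow_unbounded_of_one_lt (K * E * B) hlam
  refine ⟨J, m, fun V _ G η hG hη S hS => ?_⟩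
  classical
  have : Nonempty V := ⟨hS.choose⟩
  obtain ⟨N, hN⟩ := exists_hub_family hG hc hη S hS hJ hlam0
  let D : V → ℝ := G.distSet S hS
  have hD : ∀ x, 0 ≤ D x := G.distSet_nonneg S hS
  have hDpos : ∀ x, x ∉ S → 0 < D x := fun x hx => distSet_pos hG S hS hx
  have hDlip : ∀ x y, D y ≤ D x + G.dist x y := distSet_le_add hG S hS
  let HubAt : ℤ → V → Prop := fun ℓ h =>
    h ∈ N ℓ (G.townClass (lam ^ ℓ) h) ∧ δ * lam ^ ℓ ≤ D h ∧ D h ≤ (E + 1) * lam ^ ℓ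
  let hub : Set V := {h | ∃ ℓ, HubAt ℓ h}
  have hpow : ∀ ℓ : ℤ, 0 < lam ^ ℓ := zpow_pos hlam0
  -- the level of a hub is the largest scale it serves; the level of any other vertex is at
  -- most that of every hub at a comparable distance from `S`
  have hlevEx : ∀ x, x ∉ S → ∃ ℓ : ℤ, (x ∈ hub → HubAt ℓ x ∧ ∀ ℓ', HubAt ℓ' x → ℓ' ≤ ℓ) ∧
      (x ∉ hub → K * (E + 1) * lam ^ ℓ ≤ D x) ∧ lam ^ ℓ ≤ E * D x ∧ D x ≤ B * lam ^ ℓ := by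
    intro x hx
    have hx0 := hDpos x hx
    by_cases hxh : x ∈ hub
    · obtain ⟨b, hb⟩ := exists_mem_Ico_zpow (show 0 < E * D x by positivity) hlam
      have hup : ∀ ℓ, HubAt ℓ x → lam ^ ℓ ≤ E * D x := fun ℓ hℓ => by
        have := mul_le_mul_of_nonneg_left hℓ.2.1 (show 0 ≤ E by linarith)
        rwa [← mul_assoc, hEδ, one_mul] at this
      have hbdd : ∃ b : ℤ, ∀ ℓ, HubAt ℓ x → ℓ ≤ b := ⟨b + 1, fun ℓ hℓ =>
        ((zpow_lt_zpow_iff_right₀ hlam).1 ((hup ℓ hℓ).trans_lt hb.2)).le⟩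
      obtain ⟨ℓ, hℓ, hmax⟩ := Int.exists_greatest_of_bdd hbdd hxh
      refine ⟨ℓ, fun _ => ⟨hℓ, hmax⟩, fun h => absurd hxh h, hup ℓ hℓ, hℓ.2.2.trans ?_⟩
      exact mul_le_mul_of_nonneg_right hB0 (hpow ℓ).le
    · have hKpos : 0 < K * (E + 1) := by positivity
      obtain ⟨ℓ, h1, h2⟩ := exists_mem_Ico_zpow (div_pos hx0 hKpos) hlam
      rw [le_div_iff₀ hKpos] at h1
      rw [div_lt_iff₀ hKpos, zpow_add_one₀ hlam0.ne'] at h2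
      refine ⟨ℓ, fun h => absurd h hxh, fun _ => by linarith, ?_, ?_⟩
      · have h3 := hpow ℓ
        have : 1 ≤ K * (E + 1) := by linarith
        nlinarith
      · rw [hB]
        linarith
  choose! lev hlev using hlevEx
  have hubS : ∀ h ∈ hub, h ∉ S := by
    rintro h ⟨ℓ, -, hℓ, -⟩ hhS
    have h1 : D h ≤ G.dist h h := Finset.inf'_le _ hhS
    rw [dist_self] at h1
    have := mul_pos hδ0 (hpow ℓ)
    linarith
  let Γ := G.hubGraph lam S hub lev m
  -- vertices at a comparable distance from `S` have close levels
  have hclose : ∀ a b, a ∉ S → b ∉ S → D a ≤ K * D b → lev a ≤ lev b + m := by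
    intro a b ha hb hab
    refine (zpow_le_zpow_iff_right₀ hlam).1 ?_
    rw [zpow_add₀ hlam0.ne', zpow_natCast]
    calc lam ^ lev a ≤ E * D a := (hlev a ha).2.2.1
      _ ≤ E * (K * (B * lam ^ lev b)) := by
        have hE0 : 0 ≤ E := by linarith
        have hK0 : 0 ≤ K := by linarith
        have := (hlev b hb).2.2.2
        exact mul_le_mul_of_nonneg_left (hab.trans (mul_le_mul_of_nonneg_left this hK0)) hE0
      _ = K * E * B * lam ^ lev b := by ring
      _ ≤ lam ^ m * lam ^ lev b := mul_le_mul_of_nonneg_right hm.le (hpow _).le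
      _ = lam ^ lev b * lam ^ m := mul_comm _ _
  have hadjS : ∀ s ∈ S, ∀ x, s ≠ x → Γ.Adj s x := fun s hs x hsx =>
    (SimpleGraph.fromRel_adj _ _ _).2 ⟨hsx, Or.inl (Or.inl hs)⟩
  have hadj : ∀ (ℓ : ℤ) (h x : V), HubAt ℓ h → x ∈ G.townClass (lam ^ ℓ) h → x ∉ S →
      D h ≤ K * D x → D x ≤ K * D h → x ≠ h → Γ.Adj x h := by
    intro ℓ h x hℓ hx hxS hhx hxh hne
    have hh : h ∈ hub := ⟨ℓ, hℓ⟩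
    have hhS := hubS h hh
    obtain ⟨hhub, hmax⟩ := (hlev h hhS).1 hh
    have hcl : x ∈ G.townClass (lam ^ lev h) h :=
      townClass_antitone (zpow_le_zpow_right₀ hlam.le (hmax ℓ hℓ)) _ hx
    refine (SimpleGraph.fromRel_adj _ _ _).2 ⟨hne, ?_⟩
    -- if `x` has the larger level, then `x` is itself a hub, and serves `h`
    rcases le_or_gt (lev x) (lev h) with hl | hl
    · exact Or.inl (Or.inr ⟨hh, hl, hclose h x hhS hxS hhx, hcl⟩)
    · refine Or.inr (Or.inr ⟨?_, hl.le, hclose x h hxS hhS hxh, mem_townClass_symm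
        (townClass_antitone (zpow_le_zpow_right₀ hlam.le hl.le) _ hcl)⟩)
      by_contra hxhub
      have h1 := (hlev x hxS).2.1 hxhub
      have h2 : D x ≤ K * (E + 1) * lam ^ lev h := by
        have := mul_le_mul_of_nonneg_left hhub.2.2 (show 0 ≤ K by linarith)
        linarith
      have h3 : lam ^ lev x ≤ lam ^ lev h :=
        le_of_mul_le_mul_left (h1.trans h2) (by positivity)
      exact absurd ((zpow_le_zpow_iff_right₀ hlam).1 h3) (not_le.2 hl)
  have hconn : Γ.Connected := hubGraph_connected hS
  let H := G.metricOn hG Γ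
  have hvia : ∀ x y z, (x ≠ z → Γ.Adj x z) → (y ≠ z → Γ.Adj y z) →
      H.dist x y ≤ G.dist x z + G.dist z y := by
    intro x y z hx hy
    have h1 := metricOn_dist_le hG hx
    have h2 := metricOn_dist_le hG (x := z) (y := y) fun h => (hy h.symm).symm
    have h3 := dist_triangle (G := H) hconn x z y
    linarith
  -- a detour through `S`
  have hviaS : ∀ x y z, H.dist x y ≤ G.dist x z + G.dist z y + 2 * D z := by
    intro x y z
    obtain ⟨s, hs, hsz⟩ := G.exists_mem_dist_eq_distSet S hS z
    have h1 := hvia x y s (fun h => (hadjS s hs x h.symm).symm)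
      (fun h => (hadjS s hs y h.symm).symm)
    have h2 := dist_triangle hG x z s
    have h3 := dist_triangle hG s z y
    rw [dist_comm z s] at h2
    change G.dist s z = D z at hsz
    linarith
  have hupper : ∀ x y, D x ≤ D y → H.dist x y ≤ (1 + ε) * G.dist x y + ε * D x := by
    intro x y hxy
    have hd := G.dist_nonneg x y
    have hDx := hD x
    have hεd := mul_nonneg hε.le hd
    have hεD := mul_nonneg hε.le hDx
    have hδd : 2 * lam * (δ * G.dist x y) ≤ ε * G.dist x y := by
      have h1 := mul_le_mul_of_nonneg_right hδε hd
      have h2 : 0 ≤ lam * (δ * G.dist x y) := by positivity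
      linarith
    have hδd' : 2 * (δ * G.dist x y) ≤ 2 * lam * (δ * G.dist x y) := by
      have h2 : 0 ≤ δ * G.dist x y := by positivity
      nlinarith
    have hy := hDlip x y
    rcases le_or_gt (D x) (δ * G.dist x y) with hnear | hfar
    · have h1 := hviaS x y x
      rw [dist_self] at h1
      linarith
    have hx0 : 0 < D x := lt_of_le_of_lt (by positivity) hfar
    have hnotS : ∀ v, 0 < D v → v ∉ S := by
      intro v hv hvS
      have h1 : D v ≤ G.dist v v := Finset.inf'_le _ hvS
      rw [dist_self] at h1
      linarith
    have hxS := hnotS x hx0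
    have hyS := hnotS y (by linarith)
    rcases le_or_gt (G.dist x y) (δ * D x) with hclosed | hlong
    · -- route through a net point at scale `δ D x`
      obtain ⟨n, hn1, hn2⟩ := exists_mem_Ico_zpow (mul_pos hδ0 hx0) hlam
      have hr2 : lam ^ (n + 1) ≤ lam * (δ * D x) := by
        rw [zpow_add_one₀ hlam0.ne', mul_comm]
        exact mul_le_mul_of_nonneg_left hn1 hlam0.le
      set ℓ := n + 1
      have hr0 := hpow ℓ
      have hr8 : 8 * lam ^ ℓ ≤ D x := by
        have := mul_le_mul_of_nonneg_right hδ1 hx0.le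
        linarith
      have hrε : 8 * lam ^ ℓ ≤ ε * D x := by
        have := mul_le_mul_of_nonneg_right hδε hx0.le
        linarith
      have hxE : D x ≤ E * lam ^ ℓ := by
        have := mul_le_mul_of_nonneg_left hn2.le (show 0 ≤ E by linarith)
        rwa [← mul_assoc, hEδ, one_mul] at this
      obtain ⟨h, hhN, hhE, hxh⟩ := (hN ℓ x).2.2.2 x (mem_townClass_self _ _) hxE
      change D h ≤ _ at hhE
      have hhx := (hN ℓ x).2.1 h hhN
      rw [townClass_eq hhx] at hhN
      have h1 := hDlip h x
      have h2 := hDlip x h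
      rw [dist_comm h x] at h1
      have h3 : G.dist x y ≤ D x := hclosed.trans (mul_le_of_le_one_left hDx (by linarith))
      have hδr : δ * lam ^ ℓ ≤ lam ^ ℓ := mul_le_of_le_one_left hr0.le (by linarith)
      have hhub : HubAt ℓ h := ⟨hhN, by linarith, by linarith⟩
      have hKx := mul_le_mul_of_nonneg_right hK4 hDx
      have hKy := mul_le_mul_of_nonneg_right hK4 (hD y)
      have hKh := mul_le_mul_of_nonneg_right hK4 (hD h)
      have h4 := hvia x y h
        (hadj ℓ h x hhub (mem_townClass_symm hhx) hxS (by linarith) (by linarith))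
        (hadj ℓ h y hhub (mem_townClass_trans (mem_townClass_symm hhx)
          (mem_townClass_of_dist_lt (hclosed.trans_lt hn2))) hyS (by linarith) (by linarith))
      have h5 := dist_triangle hG h x y
      rw [dist_comm h x] at h5
      linarith
    · -- a hub on a shortest path
      have hd0 : 0 < G.dist x y := lt_of_le_of_lt (by positivity) hlong
      obtain ⟨n, hn1, hn2⟩ := exists_mem_Ico_zpow hd0 hlam
      have hr1 : lam ^ (n + 1) ≤ lam * G.dist x y := by
        rw [zpow_add_one₀ hlam0.ne', mul_comm]
        exact mul_le_mul_of_nonneg_left hn1 hlam0.le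
      have hr2 : 4 * lam ^ (n + 1) / c = lam ^ n := by
        rw [zpow_add_one₀ hlam0.ne', hlamc]
        field_simp
      set ℓ := n + 1
      have hr0 := hpow ℓ
      have hxd : D x ≤ E * G.dist x y := by
        have := mul_le_mul_of_nonneg_left hlong.le (show 0 ≤ E by linarith)
        rwa [← mul_assoc, hEδ, one_mul] at this
      have hdx : G.dist x y ≤ E * D x := by
        have := mul_le_mul_of_nonneg_left hfar.le (show 0 ≤ E by linarith)
        rwa [← mul_assoc, hEδ, one_mul] at this
      have hxE : D x ≤ E * lam ^ ℓ :=
        hxd.trans (mul_le_mul_of_nonneg_left hn2.le (by linarith))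
      obtain ⟨h, hhN, hadd⟩ := (hN ℓ x).2.2.1 x (mem_townClass_self _ _) hxE y
        (hr2.trans_le hn1) hn2
      have hhx := (hN ℓ x).2.1 h hhN
      rw [townClass_eq hhx] at hhN
      rcases le_or_gt (δ * lam ^ ℓ) (D h) with hhD | hhD
      · have h1 := hDlip x h
        have h2 := G.dist_nonneg x h
        have h3 := G.dist_nonneg h y
        have hhub : HubAt ℓ h := ⟨hhN, hhD, by linarith⟩
        have hrh : lam ^ ℓ ≤ E * D h := by
          have := mul_le_mul_of_nonneg_left hhD (show 0 ≤ E by linarith)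
          rwa [← mul_assoc, hEδ, one_mul] at this
        have hhK : D h ≤ K * D x := by
          have := mul_le_mul_of_nonneg_right hKE hDx
          linarith
        have hxy' : D y ≤ K * D h := by
          calc D y ≤ (E + 1) * G.dist x y := by linarith
            _ ≤ (E + 1) * (E * D h) :=
              mul_le_mul_of_nonneg_left (hn2.le.trans hrh) (by linarith)
            _ = (E + 1) * E * D h := (mul_assoc _ _ _).symm
            _ ≤ K * D h := mul_le_mul_of_nonneg_right hKEE (hD h)
        have hyh : D h ≤ K * D y := hhK.trans (mul_le_mul_of_nonneg_left hxy (by linarith))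
        rw [← hadd]
        have h6 := hvia x y h
          (hadj ℓ h x hhub (mem_townClass_symm hhx) hxS hhK (hxy.trans hxy'))
          (hadj ℓ h y hhub (mem_townClass_trans (mem_townClass_symm hhx)
            (mem_townClass_of_dist_lt hn2)) hyS hyh hxy')
        rw [← hadd] at hεd
        linarith
      · have h1 := hviaS x y h
        rw [hadd] at h1
        have h2 : δ * lam ^ ℓ ≤ lam * (δ * G.dist x y) := by
          have := mul_le_mul_of_nonneg_left hr1 hδ0.le
          linarith
        linarith
  refine ⟨H, hconn, hasTreewidthLE_hubGraph hlam.le fun ℓ x =>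
    ⟨N ℓ (G.townClass (lam ^ ℓ) x), (hN ℓ x).1, ?_⟩, fun u v =>
      ⟨dist_le_metricOn_dist hG hconn u v, ?_⟩⟩
  · intro a ha hal hax
    have h1 := ((hlev a (hubS a ha)).1 ha).1.1
    rwa [hal, ← townClass_eq hax] at h1
  · rcases le_total (D u) (D v) with h | h
    · rw [min_eq_left h]
      exact hupper u v h
    · rw [min_eq_right h, dist_comm u v, dist_comm u v]
      exact hupper v u h

end LengthGraph

theorem theorem4 (c : ℝ) (hc : 4 < c) :
    ∃ (C : ℝ) (f : ℕ → ℕ → ℝ → ℕ), 0 < C ∧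
      ∀ (ε : ℝ), 0 < ε →
      ∀ (V : Type*) [Finite V] (G : LengthGraph V), G.graph.Connected →
      ∀ (S : Finset V) (hS : S.Nonempty),
        ∃ (H : LengthGraph V) (φ : V → V),
          H.graph.Connected ∧
          treewidth H.graph ≤ f (G.highwayDim c) S.card ε ∧
          ∀ u v : V,
            G.dist u v ≤ H.dist (φ u) (φ v) ∧
            H.dist (φ u) (φ v) ≤
              (1 + C * ε) * G.dist u v + ε * min (G.distSet S hS u) (G.distSet S hS v) := by
  choose J m h using fun ε : {ε : ℝ // 0 < ε} =>
    LengthGraph.exists_low_treewidth_approximation hc ε.2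
  refine ⟨1, fun η k ε => if hε : 0 < ε then
    k + (m ⟨ε, hε⟩ + 1) * (k * (η + 1) ^ (J ⟨ε, hε⟩ + 1)) else 0, one_pos, ?_⟩
  intro ε hε V _ G hG S hS
  obtain ⟨H, hH, htw, hdist⟩ := h ⟨ε, hε⟩ V G (G.highwayDim c) hG
    (G.hasHighwayDimLE_highwayDim c) S hS
  refine ⟨H, id, hH, ?_, fun u v => ?_⟩
  · simp only [dif_pos hε]
    exact treewidth_le htw
  · rw [one_mul]
    exact hdist u v
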